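/- Let $(X,d)$ be a compact perfect metric space. A map $f:X\to X$ is an infinitesimal similitude if for every $x\in X$ there is a number $(Df)(x)$ with $\lim_{m}\frac{d(f(x_m),f(y_m))}{d(x_m,y_m)}=(Df)(x)$ for all sequences $x_m\to x$, $y_m\to x$ with $x_m\neq y_m$ for all $m$. Let $f_1,\dots,f_N:X\to X$ be contractions that are infinitesimal similitudes, such that each function $x\mapsto (Df_i)(x)$ is strictly positive and Hölder continuous on $X$, and let $(p_1,\dots,p_N)$ be a probability vector with $p_i>0$ for all $i$. For a nonempty word $w=w_1\cdots w_n$ over $\{1,\dots,N\}$ put $f_w=f_{w_1}\circ\cdots\circ f_{w_n}$, and assume that there is a constant $C\ge 1$ such that $$\frac{(Df_w)(x)}{C}\le\frac{d(f_w(x),f_w(y))}{d(x,y)}\le C\,(Df_w)(x)\qquad\text{for all nonempty words } w \text{ and all } x\ne y \text{ in } X .$$ Let $E$ be the attractor, i.e. the nonempty compact set with $E=\bigcup_{i=1}^N f_i(E)$, and assume the strong open set condition (SOSC): there is a bounded nonempty open set $G\subset X$ with $\bigcup_i f_i(G)\subset G$, $f_i(G)\cap f_j(G)=\emptyset$ for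 $i\neq j$, and $E\cap G\ne\emptyset$. Let $\mu$ be the Borel probability measure on $X$ with $\mu=\sum_{i=1}^N p_i\,\mu\circ f_i^{-1}$. Let $0<r<\infty$. For $\sigma\ge 0$ let $L_{\sigma,r}$ be the bounded operator on $\mathcal C(X)$ given by $$(L_{\sigma,r}\Phi)(x)=\sum_{i=1}^N\bigl(p_i\,(Df_i)(x)^r\bigr)^{\frac{\sigma}{r+\sigma}}\,\Phi(f_i(x)),$$ and let $\sigma_r\ge 0$ be the number for which the spectral radius of $L_{\sigma_r,r}$ equals $1$. For $n\in\mathbb N$ put $$V_{n,r}(\mu)=\inf\Bigl\{\int d(x,A)^r\,d\mu(x): A\subset X,\ \mathrm{Card}(A)\le n\Bigr\},\qquad e_{n,r}(\mu)=V_{n,r}(\mu)^{1/r},$$ and let $\underline D_r(\mu)=\liminf_{n\to\infty}\dfrac{r\log n}{-\log V_{n,r}(\mu)}$ be the lower quantization dimension of order $r$ (with $-\log 0=\infty$ and $a/\infty=0$). Then for every $l$ with $0<l<\sigma_r$, $$\liminf_{n\to\infty}\, n\,\bigl(e_{n,r}(\mu)\bigr)^{l}>0 ,$$ and consequently $\underline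 D_r(\mu)\ge\sigma_r$. -/

import Mathlib

open Filter Topology MeasureTheory
open scoped NNReal ENNReal

noncomputable section

/-- The function `f` has infinitesimal derivative `L` at `x`: for all sequences `u`, `v` with
`u m ≠ v m` that converge to `x`, the quotients `d(f(u m), f(v m)) / d(u m, v m)` converge
to `L` (the same `L` for all such sequences). -/
def HasInfDerivAt {X : Type*} [MetricSpace X] (f : X → X) (x : X) (L : ℝ) : Prop :=
  ∀ u v : ℕ → X, (∀ m, u m ≠ v m) → Tendsto u atTop (𝓝 x) → Tendsto v atTop (𝓝 x) →
    Tendsto (fun m => dist (f (u m)) (f (v m)) / dist (u m) (v m)) atTop (𝓝 L)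

/-- `f` is an infinitesimal similitude at `x`. -/
def IsInfSimilitudeAt {X : Type*} [MetricSpace X] (f : X → X) (x : X) : Prop :=
  ∃ L : ℝ, HasInfDerivAt f x L

open Classical in
/-- The infinitesimal derivative `(Df)(x)`. In a space without isolated points it is the unique
`L` with `HasInfDerivAt f x L`, if there is one (and `0` otherwise). -/
def infDeriv {X : Type*} [MetricSpace X] (f : X → X) (x : X) : ℝ :=
  if h : IsInfSimilitudeAt f x then Classical.choose h else 0

/-- A weighted iterated function system on `X`: finitely many contractive infinitesimal
similitudes `f_1, …, f_N` whose derivatives `x ↦ (Df_i)(x)` are strictly positive and Hölder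
continuous, with a probability vector `(p_1, …, p_N)` with positive entries. -/
structure InfSimilitudeIFS (X : Type*) [MetricSpace X] (N : ℕ) where
  /-- the maps of the system -/
  f : Fin N → X → X
  contracting : ∀ i, ∃ c : ℝ≥0, ContractingWith c (f i)
  infSimilitude : ∀ i x, IsInfSimilitudeAt (f i) x
  infDeriv_pos : ∀ i x, 0 < infDeriv (f i) x
  infDeriv_holder : ∀ i, ∃ K s : ℝ≥0, 0 < s ∧ HolderWith K s (infDeriv (f i))
  /-- the probability vector -/
  p : Fin N → ℝ
  p_pos : ∀ i, 0 < p i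
  p_sum : ∑ i, p i = 1

namespace InfSimilitudeIFS

variable {X : Type*} [MetricSpace X] {N : ℕ}

theorem continuous_f (S : InfSimilitudeIFS X N) (i : Fin N) : Continuous (S.f i) := by
  obtain ⟨c, hc⟩ := S.contracting i
  exact hc.2.continuous

/-- The weight `x ↦ (p_i (Df_i)(x)^r)^(σ/(r+σ))`. -/
def weight (S : InfSimilitudeIFS X N) (r σ : ℝ) (i : Fin N) (x : X) : ℝ :=
  (S.p i * infDeriv (S.f i) x ^ r) ^ (σ / (r + σ))

theorem continuous_weight (S : InfSimilitudeIFS X N) (r σ : ℝ) (i : Fin N) :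
    Continuous (S.weight r σ i) := by
  obtain ⟨K, s, hs, h⟩ := S.infDeriv_holder i
  have hD : Continuous (infDeriv (S.f i)) := h.continuous hs
  have hpos := S.infDeriv_pos i
  refine Continuous.rpow_const (continuous_const.mul
    (hD.rpow_const fun x => Or.inl (hpos x).ne')) fun x => Or.inl ?_
  exact (mul_pos (S.p_pos i) (Real.rpow_pos_of_pos (hpos x) r)).ne'

/-- The bounded operator `(L_{σ,r} Φ)(x) = ∑ i, (p_i (Df_i)(x)^r)^(σ/(r+σ)) Φ(f_i(x))` on the
Banach space of continuous functions on `X` with the supremum norm. The scalars are complex, so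
that the spectral radius is the usual one (that of the complexification of the operator on
real-valued functions). -/
def transferOp [CompactSpace X] (S : InfSimilitudeIFS X N) (r σ : ℝ) :
    C(X, ℂ) →L[ℂ] C(X, ℂ) :=
  LinearMap.mkContinuous
    { toFun := fun Φ =>
        { toFun := fun x => ∑ i, (S.weight r σ i x : ℂ) * Φ (S.f i x)
          continuous_toFun := continuous_finsetSum _ fun i _ =>
            (Complex.continuous_ofReal.comp (S.continuous_weight r σ i)).mul
              (Φ.continuous.comp (S.continuous_f i)) }
      map_add' := fun Φ Ψ => by
        ext x
        simp [mul_add, Finset.sum_add_distrib]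
      map_smul' := fun a Φ => by
        ext x
        simp only [ContinuousMap.coe_mk, ContinuousMap.smul_apply, smul_eq_mul, RingHom.id_apply,
          Finset.mul_sum]
        exact Finset.sum_congr rfl fun i _ => by ring }
    (∑ i, ‖(⟨S.weight r σ i, S.continuous_weight r σ i⟩ : C(X, ℝ))‖)
    (fun Φ => by
      have h0 : 0 ≤ (∑ i, ‖(⟨S.weight r σ i, S.continuous_weight r σ i⟩ : C(X, ℝ))‖) * ‖Φ‖ :=
        mul_nonneg (Finset.sum_nonneg fun i _ => norm_nonneg _) (norm_nonneg _)
      rw [ContinuousMap.norm_le _ h0]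
      intro x
      change ‖∑ i, (S.weight r σ i x : ℂ) * Φ (S.f i x)‖ ≤ _
      refine (norm_sum_le _ _).trans ?_
      rw [Finset.sum_mul]
      refine Finset.sum_le_sum fun i _ => ?_
      rw [norm_mul, Complex.norm_real]
      exact mul_le_mul
        ((⟨S.weight r σ i, S.continuous_weight r σ i⟩ : C(X, ℝ)).norm_coe_le_norm x)
        (Φ.norm_coe_le_norm _) (norm_nonneg _) (norm_nonneg _))

theorem transferOp_apply [CompactSpace X] (S : InfSimilitudeIFS X N) (r σ : ℝ) (Φ : C(X, ℂ))
    (x : X) :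
    S.transferOp r σ Φ x
      = ∑ i, (((S.p i * infDeriv (S.f i) x ^ r) ^ (σ / (r + σ)) : ℝ) : ℂ) * Φ (S.f i x) :=
  rfl

/-- `f_w = f_{w_1} ∘ ⋯ ∘ f_{w_n}` for a word `w = w_1 ⋯ w_n`. -/
def wordMap (S : InfSimilitudeIFS X N) : List (Fin N) → X → X
  | [] => id
  | i :: w => S.f i ∘ S.wordMap w

/-- The standing distortion hypothesis: with one constant `C` for all nonempty words `w` and all
points `x ≠ y`, the quotient `d(f_w(x), f_w(y)) / d(x, y)` is comparable to `(Df_w)(x)`. -/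
def DistortionHypothesis (S : InfSimilitudeIFS X N) : Prop :=
  ∃ C : ℝ, 1 ≤ C ∧ ∀ w : List (Fin N), w ≠ [] → ∀ x y : X, x ≠ y →
    infDeriv (S.wordMap w) x / C ≤ dist (S.wordMap w x) (S.wordMap w y) / dist x y ∧
    dist (S.wordMap w x) (S.wordMap w y) / dist x y ≤ C * infDeriv (S.wordMap w) x

/-- `E` is the attractor: a nonempty compact set with `E = ⋃ i, f_i(E)`. -/
def IsAttractor (S : InfSimilitudeIFS X N) (E : Set X) : Prop :=
  E.Nonempty ∧ IsCompact E ∧ E = ⋃ i, S.f i '' E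

/-- The strong open set condition. -/
def SOSC (S : InfSimilitudeIFS X N) : Prop :=
  ∃ G : Set X, IsOpen G ∧ G.Nonempty ∧ Bornology.IsBounded G ∧ (∀ i, S.f i '' G ⊆ G) ∧
    (∀ i j, i ≠ j → Disjoint (S.f i '' G) (S.f j '' G)) ∧
    ∃ E : Set X, S.IsAttractor E ∧ (E ∩ G).Nonempty

/-- `μ = ∑ i, p_i • (μ ∘ f_i⁻¹)`. -/
def IsInvariantMeasure [MeasurableSpace X] (S : InfSimilitudeIFS X N) (μ : Measure X) : Prop :=
  μ = ∑ i, ENNReal.ofReal (S.p i) • μ.map (S.f i)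

end InfSimilitudeIFS

/-- `V_{n,r}(μ)`, the `n`-th quantization error of order `r`: the infimum of `∫ d(x, A)^r dμ(x)`
over sets `A` with at most `n` points, as an extended nonnegative number (`d(x, ∅) = ∞`). -/
def quantErrorV {X : Type*} [MetricSpace X] [MeasurableSpace X] (μ : Measure X) (r : ℝ) (n : ℕ) :
    ℝ≥0∞ :=
  ⨅ (A : Finset X) (_ : A.card ≤ n), ∫⁻ x, Metric.infEDist x (A : Set X) ^ r ∂μ

/-- `e_{n,r}(μ) = V_{n,r}(μ)^(1/r)`. -/
def quantError {X : Type*} [MetricSpace X] [MeasurableSpace X] (μ : Measure X) (r : ℝ) (n : ℕ) :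
    ℝ≥0∞ :=
  quantErrorV μ r n ^ (1 / r)

/-- The lower quantization dimension of order `r`: the lower limit of
`r log n / (- log V_{n,r}(μ))`, where `- log 0 = ∞` and `a / ∞ = 0`. -/
def lowerQuantDim {X : Type*} [MetricSpace X] [MeasurableSpace X] (μ : Measure X) (r : ℝ) :
    EReal :=
  liminf (fun n : ℕ => ((r * Real.log n : ℝ) : EReal) / (-ENNReal.log (quantErrorV μ r n))) atTop

end

/-! The theorem reduces to a finite family of maps `g i` with separated images, lower Lipschitz
constants `a i`, and a measure dominating `∑ q i • μ.map (g i)`. A point close to one image is far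
from the others, so `n` quantizing points split into disjoint groups of sizes `n i`. Rescaling
bounds the error below by a constant times `∑ w i * n i ^ (-β)`, where `w i = q i * a i ^ r`. If `∑
w i ^ (1 + β)⁻¹ ≥ 1`, Hölder's inequality bounds this sum below by `n ^ (-β)`, and induction on `n`
closes (`exists_const_le_lintegral_min_of_separated`).

Such a family exists for `β = r / l` whenever `0 < l < σ`. Spectral radius 1 keeps the sums of word
weights with exponent `σ / (r + σ)` at least 1 for every positive word length, up to distortion
(`one_le_sum_words_of_spectralRadius`). Lowering the exponent to `l / (r + l)` gains a factor
growing exponentially with the length (`exists_large_sum_words`). This gain pays for the distortion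
and for appending to every word `v` a fixed word `u` that maps `X` into the open set `G`. The images
of `X` under the words `v ++ u` then lie in the disjoint sets `f_v(G)`, and compactness separates
them. -/

/-! ### Quantization lower bound for separated families -/

theorem rpow_neg_le_sum_mul_rpow_neg {ι : Type*} [Fintype ι] {w : ι → ℝ} {n : ι → ℝ}
    {M β : ℝ} (hβ : 0 ≤ β) (hw : ∀ i, 0 ≤ w i) (hn : ∀ i, 0 < n i) (hM : ∑ i, n i ≤ M)
    (hM0 : 0 < M) (hsum : 1 ≤ ∑ i, w i ^ (1 + β)⁻¹) :
    M ^ (-β) ≤ ∑ i, w i * n i ^ (-β) := by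
  have h1β : 0 < 1 + β := by linarith
  -- Hölder with exponent `1 + β` and weights `n i`, applied to `w i ^ (1 + β)⁻¹ / n i`: the left
  -- side becomes `∑ w i ^ (1 + β)⁻¹`, and the `1 + β` power sum becomes `∑ w i * n i ^ (-β)`.
  have key := Real.inner_le_weight_mul_Lp_of_nonneg Finset.univ (p := 1 + β) (by linarith)
    n (fun i => w i ^ (1 + β)⁻¹ / n i) (fun i => (hn i).le)
    (fun i => div_nonneg (Real.rpow_nonneg (hw i) _) (hn i).le)
  have e1 : ∀ i, n i * (w i ^ (1 + β)⁻¹ / n i) = w i ^ (1 + β)⁻¹ := fun i =>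
    mul_div_cancel₀ _ (hn i).ne'
  have e2 : ∀ i, n i * (w i ^ (1 + β)⁻¹ / n i) ^ (1 + β) = w i * n i ^ (-β) := fun i => by
    rw [Real.div_rpow (Real.rpow_nonneg (hw i) _) (hn i).le, ← Real.rpow_mul (hw i),
      inv_mul_cancel₀ h1β.ne', Real.rpow_one, Real.rpow_add (hn i), Real.rpow_one,
      Real.rpow_neg (hn i).le]
    have := (hn i).ne'
    have := (Real.rpow_pos_of_pos (hn i) β).ne'
    field_simp
  simp only [e1, e2] at key
  set S := ∑ i, w i * n i ^ (-β) with hS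
  have hS0 : 0 ≤ S := Finset.sum_nonneg fun i _ => mul_nonneg (hw i) (Real.rpow_nonneg (hn i).le _)
  have hsn : 0 ≤ ∑ i, n i := Finset.sum_nonneg fun i _ => (hn i).le
  have hexp : (1 : ℝ) - (1 + β)⁻¹ = β * (1 + β)⁻¹ := by field_simp; ring
  have h2 : 1 ≤ M ^ (β * (1 + β)⁻¹) * S ^ (1 + β)⁻¹ := by
    refine (hsum.trans key).trans ?_
    rw [hexp]
    gcongr
  have h3 : 1 ≤ M ^ β * S := by
    have := Real.rpow_le_rpow zero_le_one h2 h1β.le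
    rwa [Real.one_rpow, Real.mul_rpow (by positivity) (by positivity), ← Real.rpow_mul hM0.le,
      ← Real.rpow_mul hS0, mul_assoc, inv_mul_cancel₀ h1β.ne', mul_one, Real.rpow_one] at this
  rw [Real.rpow_neg hM0.le]
  exact (inv_le_iff_one_le_mul₀' (Real.rpow_pos_of_pos hM0 β)).2 h3

/-- The pointwise scaling step: passing to the indices whose functions come close to `g x`. -/
theorem mul_min_biInf_div_le {J : Type*} {A B : Finset J} {δ a : ℝ≥0∞} (ha0 : a ≠ 0)
    (ha1 : a ≤ 1) {h : J → ℝ≥0∞} (hB : ∀ j ∈ A, j ∉ B → δ ≤ h j) :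
    a * min δ (⨅ j ∈ B, h j / a) ≤ min δ (⨅ j ∈ A, h j) := by
  have ha : a ≠ ∞ := (ha1.trans_lt ENNReal.one_lt_top).ne
  have hδ : a * min δ (⨅ j ∈ B, h j / a) ≤ δ :=
    (mul_le_mul' ha1 (min_le_left _ _)).trans (one_mul δ).le
  refine le_min hδ (le_iInf₂ fun j hj => ?_)
  by_cases hjB : j ∈ B
  · calc a * min δ (⨅ j ∈ B, h j / a) ≤ a * (h j / a) := by
          gcongr
          exact (min_le_right _ _).trans (iInf₂_le j hjB)
      _ = h j := ENNReal.mul_div_cancel ha0 ha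
  · exact hδ.trans (hB j hj hjB)

/-- Lower bound for the truncated quantization integral of a measure which dominates a sum of
images of itself under a separated finite family of maps with lower Lipschitz bounds. -/
theorem exists_const_le_lintegral_min_of_separated {X : Type*} [MetricSpace X]
    [MeasurableSpace X] (μ : Measure X) [IsProbabilityMeasure μ] {ι : Type*} [Fintype ι]
    (g : ι → X → X) (hg : ∀ i, Measurable (g i)) (q a : ι → ℝ≥0) (hq : ∀ i, 0 < q i)
    (ha0 : ∀ i, 0 < a i) (ha1 : ∀ i, a i ≤ 1)
    (hlip : ∀ i x y, (a i : ℝ≥0∞) * edist x y ≤ edist (g i x) (g i y))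
    {δ : ℝ≥0} (hδ : 0 < δ) (hsep : ∀ i j, i ≠ j → ∀ x y, 2 * (δ : ℝ≥0∞) ≤ edist (g i x) (g j y))
    (hμ : ∀ F : X → ℝ≥0∞, Measurable F → ∑ i, (q i : ℝ≥0∞) * ∫⁻ x, F (g i x) ∂μ ≤ ∫⁻ x, F x ∂μ)
    {r β : ℝ} (hr : 0 < r) (hβ : 0 < β) (hw : ∀ i, (q i : ℝ) * (a i : ℝ) ^ r < 1)
    (hsum : 1 ≤ ∑ i, ((q i : ℝ) * (a i : ℝ) ^ r) ^ (1 + β)⁻¹) :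
    ∃ c : ℝ, 0 < c ∧ ∀ (J : Type _) (n : ℕ), 1 ≤ n → ∀ A : Finset J, A.card ≤ n →
      ∀ h : J → X → ℝ≥0∞, (∀ j, Measurable (h j)) → (∀ j x y, edist x y ≤ h j x + h j y) →
      ENNReal.ofReal (c * (n : ℝ) ^ (-β)) ≤ ∫⁻ x, (min (δ : ℝ≥0∞) (⨅ j ∈ A, h j x)) ^ r ∂μ := by
  classical
  have hw0 : ∀ i, 0 < (q i : ℝ) * (a i : ℝ) ^ r := fun i =>
    mul_pos (hq i) (Real.rpow_pos_of_pos (ha0 i) r)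
  have hne : Nonempty ι := by
    by_contra hι
    rw [not_nonempty_iff] at hι
    simp at hsum
    linarith
  -- A single weight below 1 cannot satisfy `hsum`. Two indices are needed so that the groups in the
  -- induction are strictly smaller than `n`.
  have hnt : Nontrivial ι := by
    by_contra hι
    rw [not_nontrivial_iff_subsingleton] at hι
    obtain ⟨i⟩ := hne
    rw [Fintype.sum_subsingleton _ i] at hsum
    exact absurd hsum (not_le.2 (Real.rpow_lt_one (hw0 i).le (hw i) (by positivity)))
  obtain ⟨c, hc0, hc⟩ : ∃ c : ℝ, 0 < c ∧ ∀ i, c ≤ (q i : ℝ) * (δ : ℝ) ^ r := by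
    obtain ⟨i, hi⟩ := Finite.exists_min q
    exact ⟨q i * (δ : ℝ) ^ r, mul_pos (hq i) (Real.rpow_pos_of_pos hδ r), fun j =>
      mul_le_mul_of_nonneg_right (hi j) (by positivity)⟩
  -- The induction runs over general functions `h j` rather than distances to points, because the
  -- pullback of a distance under `g i` need not be a distance to a point of `X`. The inequality
  -- `edist x y ≤ h j x + h j y` is all that is used, and it survives pullback and rescaling.
  refine ⟨c, hc0, fun J n => ?_⟩
  induction n using Nat.strong_induction_on with
  | _ n ih =>
  intro hn A hA h hm hh
  have hn0 : (0 : ℝ) < n := by exact_mod_cast hn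
  set F : X → ℝ≥0∞ := fun x => (min (δ : ℝ≥0∞) (⨅ j ∈ A, h j x)) ^ r with hF
  have hFm : Measurable F :=
    (measurable_const.min (Measurable.biInf _ A.countable_toSet fun j _ => hm j)).pow_const r
  -- The indices that matter on the image of `g i`; all others are hidden there by the truncation at
  -- `δ`. An index in two groups would violate the separation by `2 * δ`.
  set B : ι → Finset J := fun i => A.filter fun j => ∃ x, h j (g i x) < δ with hB
  have hdisj : ∀ i k, i ≠ k → Disjoint (B i) (B k) := by
    intro i k hik
    rw [Finset.disjoint_left]
    intro j hji hjk
    obtain ⟨x, hx⟩ := (Finset.mem_filter.1 hji).2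
    obtain ⟨y, hy⟩ := (Finset.mem_filter.1 hjk).2
    have h1 := (hsep i k hik x y).trans (hh j _ _)
    have h2 := ENNReal.add_lt_add hx hy
    rw [← two_mul] at h2
    exact absurd h1 (not_le.2 h2)
  have hcard : ∑ i, (B i).card ≤ n := by
    rw [← Finset.card_biUnion fun i _ k _ hik => hdisj i k hik]
    exact (Finset.card_le_card (Finset.biUnion_subset.2 fun i _ => Finset.filter_subset _ _)).trans
      hA
  have hnotB : ∀ i x, ∀ j ∈ A, j ∉ B i → (δ : ℝ≥0∞) ≤ h j (g i x) := by
    intro i x j hj hjB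
    by_contra hlt
    exact hjB (Finset.mem_filter.2 ⟨hj, x, not_le.1 hlt⟩)
  have hδr : (δ : ℝ≥0∞) ^ r = ENNReal.ofReal ((δ : ℝ) ^ r) := by
    rw [← ENNReal.ofReal_rpow_of_pos (by exact_mod_cast hδ), ENNReal.ofReal_coe_nnreal]
  -- An image with no index nearby contributes `q i * δ ^ r` by itself, which is at least `c`.
  by_cases hempty : ∃ i, B i = ∅
  · obtain ⟨i, hi⟩ := hempty
    have hFi : ∀ x, F (g i x) = (δ : ℝ≥0∞) ^ r := by
      intro x
      simp only [hF]
      rw [min_eq_left]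
      exact le_iInf₂ fun j hj => hnotB i x j hj (by simp [hi])
    calc ENNReal.ofReal (c * (n : ℝ) ^ (-β)) ≤ ENNReal.ofReal ((q i : ℝ) * (δ : ℝ) ^ r) := by
          refine ENNReal.ofReal_le_ofReal (le_trans ?_ (hc i))
          exact mul_le_of_le_one_right hc0.le
            (Real.rpow_le_one_of_one_le_of_nonpos (by exact_mod_cast hn) (by linarith))
      _ = (q i : ℝ≥0∞) * ∫⁻ x, F (g i x) ∂μ := by
          rw [ENNReal.ofReal_mul (by positivity), ENNReal.ofReal_coe_nnreal]
          simp [hFi, hδr]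
      _ ≤ ∑ i, (q i : ℝ≥0∞) * ∫⁻ x, F (g i x) ∂μ :=
          Finset.single_le_sum (f := fun i => (q i : ℝ≥0∞) * ∫⁻ x, F (g i x) ∂μ)
            (fun _ _ => zero_le) (Finset.mem_univ i)
      _ ≤ _ := hμ F hFm
  · push Not at hempty
    have hB1 : ∀ i, 1 ≤ (B i).card := fun i => Finset.card_pos.2 (hempty i)
    have hBlt : ∀ i, (B i).card < n := by
      intro i
      obtain ⟨k, hk⟩ := exists_ne i
      have := Finset.add_le_sum (f := fun i => (B i).card) (s := Finset.univ)
        (fun _ _ => Nat.zero_le _) (Finset.mem_univ i) (Finset.mem_univ k) hk.symm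
      have := hB1 k
      omega
    have hi : ∀ i, ENNReal.ofReal ((a i : ℝ) ^ r * (c * ((B i).card : ℝ) ^ (-β)))
        ≤ ∫⁻ x, F (g i x) ∂μ := by
      intro i
      have hai : (a i : ℝ≥0∞) ≠ 0 := by exact_mod_cast (ha0 i).ne'
      -- Dividing by `a i` compensates the contraction of `g i` and restores the triangle-type
      -- inequality.
      have IH := ih _ (hBlt i) (hB1 i) (B i) le_rfl (fun j x => h j (g i x) / a i)
        (fun j => ((hm j).comp (hg i)).div_const _) (fun j x y => by
          rw [← ENNReal.add_div, ENNReal.le_div_iff_mul_le (Or.inl hai)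
            (Or.inl ENNReal.coe_ne_top), mul_comm]
          exact (hlip i x y).trans (hh j _ _))
      rw [ENNReal.ofReal_mul (by positivity), ← ENNReal.ofReal_rpow_of_pos (by exact_mod_cast ha0 i),
        ENNReal.ofReal_coe_nnreal]
      refine (mul_le_mul_right IH _).trans ?_
      rw [← lintegral_const_mul' _ _ (by
        exact (ENNReal.rpow_lt_top_of_nonneg hr.le ENNReal.coe_ne_top).ne)]
      refine lintegral_mono fun x => ?_
      rw [← ENNReal.mul_rpow_of_nonneg _ _ hr.le]
      exact ENNReal.rpow_le_rpow (mul_min_biInf_div_le hai (by exact_mod_cast ha1 i)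
        (fun j hj hjB => hnotB i x j hj hjB)) hr.le
    refine le_trans ?_ (hμ F hFm)
    have hreal : c * (n : ℝ) ^ (-β)
        ≤ ∑ i, (q i : ℝ) * ((a i : ℝ) ^ r * (c * ((B i).card : ℝ) ^ (-β))) := by
      have := rpow_neg_le_sum_mul_rpow_neg hβ.le (fun i => (hw0 i).le)
        (n := fun i => ((B i).card : ℝ)) (fun i => by exact_mod_cast hB1 i) (M := n)
        (by exact_mod_cast hcard) hn0 hsum
      calc c * (n : ℝ) ^ (-β) ≤ c * _ := mul_le_mul_of_nonneg_left this hc0.le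
        _ = _ := by
          rw [Finset.mul_sum]
          exact Finset.sum_congr rfl fun i _ => by ring
    refine (ENNReal.ofReal_le_ofReal hreal).trans ?_
    rw [ENNReal.ofReal_sum_of_nonneg fun i _ => by positivity]
    refine Finset.sum_le_sum fun i _ => ?_
    rw [ENNReal.ofReal_mul (by positivity), ENNReal.ofReal_coe_nnreal]
    gcongr
    exact hi i

/-! ### Uniqueness and chain rule for infinitesimal derivatives -/

section InfDeriv

variable {X : Type*} [MetricSpace X]

/-- Perfectness supplies a sequence of points other than `x` converging to `x`; paired with the
constant sequence, it determines the limit. -/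
theorem HasInfDerivAt.unique [PerfectSpace X] {f : X → X} {x : X} {L M : ℝ}
    (hL : HasInfDerivAt f x L) (hM : HasInfDerivAt f x M) : L = M := by
  have hx : x ∈ closure ({x}ᶜ : Set X) := by
    rw [mem_closure_iff_nhdsWithin_neBot]
    exact perfectSpace_iff_forall_not_isolated.1 inferInstance x
  obtain ⟨u, hu, hux⟩ := mem_closure_iff_seq_limit.1 hx
  exact tendsto_nhds_unique (hL u (fun _ => x) hu hux tendsto_const_nhds)
    (hM u (fun _ => x) hu hux tendsto_const_nhds)

theorem IsInfSimilitudeAt.hasInfDerivAt {f : X → X} {x : X} (h : IsInfSimilitudeAt f x) :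
    HasInfDerivAt f x (infDeriv f x) := by
  rw [infDeriv, dif_pos h]
  exact Classical.choose_spec h

theorem HasInfDerivAt.infDeriv_eq [PerfectSpace X] {f : X → X} {x : X} {L : ℝ}
    (h : HasInfDerivAt f x L) : infDeriv f x = L :=
  (IsInfSimilitudeAt.hasInfDerivAt ⟨L, h⟩).unique h

theorem hasInfDerivAt_id (x : X) : HasInfDerivAt id x 1 := by
  intro u v huv _ _
  have : (fun m => dist (id (u m)) (id (v m)) / dist (u m) (v m)) = fun _ => (1 : ℝ) :=
    funext fun m => div_self (dist_ne_zero.2 (huv m))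
  rw [this]
  exact tendsto_const_nhds

/-- Difference quotients multiply. Injectivity of `g` keeps the image pairs distinct, so that they
are admissible for `f`. -/
theorem HasInfDerivAt.comp {f g : X → X} {x : X} {L M : ℝ} (hf : HasInfDerivAt f (g x) M)
    (hg : HasInfDerivAt g x L) (hinj : Function.Injective g) (hcont : ContinuousAt g x) :
    HasInfDerivAt (f ∘ g) x (M * L) := by
  intro u v huv hu hv
  have hguv : ∀ m, g (u m) ≠ g (v m) := fun m h => huv m (hinj h)
  refine ((hf (g ∘ u) (g ∘ v) hguv (hcont.tendsto.comp hu) (hcont.tendsto.comp hv)).mul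
    (hg u v huv hu hv)).congr fun m => ?_
  exact div_mul_div_cancel₀ (dist_ne_zero.2 (hguv m))

end InfDeriv

/-! ### Word maps, their derivatives and iterates of the transfer operator -/

namespace InfSimilitudeIFS

variable {X : Type*} [MetricSpace X] {N : ℕ} (S : InfSimilitudeIFS X N)

theorem injective_f (hdist : S.DistortionHypothesis) (i : Fin N) :
    Function.Injective (S.f i) := by
  obtain ⟨C, hC, h⟩ := hdist
  intro x y hxy
  by_contra hne
  have h1 := (h [i] (by simp) x y hne).1
  have h2 : dist (S.wordMap [i] x) (S.wordMap [i] y) = 0 := dist_eq_zero.2 hxy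
  rw [h2, zero_div] at h1
  exact absurd h1 (not_le.2 (div_pos (S.infDeriv_pos i x) (by linarith)))

theorem injective_wordMap (hdist : S.DistortionHypothesis) :
    ∀ w : List (Fin N), Function.Injective (S.wordMap w)
  | [] => Function.injective_id
  | i :: w => (S.injective_f hdist i).comp (injective_wordMap hdist w)

theorem continuous_wordMap : ∀ w : List (Fin N), Continuous (S.wordMap w)
  | [] => continuous_id
  | i :: w => (S.continuous_f i).comp (continuous_wordMap w)

theorem wordMap_append (v w : List (Fin N)) :
    S.wordMap (v ++ w) = S.wordMap v ∘ S.wordMap w := by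
  induction v with
  | nil => rfl
  | cons i v ih => simp only [List.cons_append, wordMap, ih, Function.comp_assoc]

theorem isInfSimilitudeAt_wordMap (hdist : S.DistortionHypothesis) :
    ∀ (w : List (Fin N)) (x : X), IsInfSimilitudeAt (S.wordMap w) x
  | [], x => ⟨1, hasInfDerivAt_id x⟩
  | i :: w, x => ⟨_, (S.infSimilitude i (S.wordMap w x)).hasInfDerivAt.comp
      (isInfSimilitudeAt_wordMap hdist w x).hasInfDerivAt (S.injective_wordMap hdist w)
      (S.continuous_wordMap w).continuousAt⟩

theorem infDeriv_wordMap_nil [PerfectSpace X] (x : X) : infDeriv (S.wordMap []) x = 1 :=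
  (hasInfDerivAt_id x).infDeriv_eq

theorem infDeriv_wordMap_cons [PerfectSpace X] (hdist : S.DistortionHypothesis) (i : Fin N)
    (w : List (Fin N)) (x : X) :
    infDeriv (S.wordMap (i :: w)) x
      = infDeriv (S.f i) (S.wordMap w x) * infDeriv (S.wordMap w) x :=
  ((S.infSimilitude i (S.wordMap w x)).hasInfDerivAt.comp
    (S.isInfSimilitudeAt_wordMap hdist w x).hasInfDerivAt (S.injective_wordMap hdist w)
    (S.continuous_wordMap w).continuousAt).infDeriv_eq

theorem infDeriv_wordMap_pos [PerfectSpace X] (hdist : S.DistortionHypothesis)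
    (w : List (Fin N)) (x : X) : 0 < infDeriv (S.wordMap w) x := by
  induction w with
  | nil => rw [infDeriv_wordMap_nil]; exact one_pos
  | cons i w ih =>
    rw [S.infDeriv_wordMap_cons hdist]
    exact mul_pos (S.infDeriv_pos i _) ih

/-- The product of the probabilities of the letters of a word. -/
def wordProb (w : List (Fin N)) : ℝ := (w.map S.p).prod

theorem wordProb_cons (i : Fin N) (w : List (Fin N)) :
    S.wordProb (i :: w) = S.p i * S.wordProb w := by
  simp [wordProb]

theorem wordProb_append (v w : List (Fin N)) :
    S.wordProb (v ++ w) = S.wordProb v * S.wordProb w := by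
  simp [wordProb]

theorem wordProb_pos (w : List (Fin N)) : 0 < S.wordProb w := by
  induction w with
  | nil => simp [wordProb]
  | cons i w ih => rw [wordProb_cons]; exact mul_pos (S.p_pos i) ih

theorem p_le_one (i : Fin N) : S.p i ≤ 1 := by
  rw [← S.p_sum]
  exact Finset.single_le_sum (fun j _ => (S.p_pos j).le) (Finset.mem_univ i)

theorem wordProb_le_one (w : List (Fin N)) : S.wordProb w ≤ 1 := by
  induction w with
  | nil => simp [wordProb]
  | cons i w ih =>
    rw [wordProb_cons]
    exact mul_le_one₀ (S.p_le_one i) (S.wordProb_pos w).le ih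

theorem sum_words_succ {M : Type*} [AddCommMonoid M] (m : ℕ) (F : List (Fin N) → M) :
    ∑ v : Fin (m + 1) → Fin N, F (List.ofFn v)
      = ∑ i : Fin N, ∑ v : Fin m → Fin N, F (i :: List.ofFn v) := by
  rw [← (Fin.consEquiv fun _ => Fin N).sum_comp, Fintype.sum_prod_type]
  refine Finset.sum_congr rfl fun i _ => Finset.sum_congr rfl fun v _ => ?_
  exact congrArg F (List.ofFn_cons i v)

/-- The chain rule makes the weights multiplicative along words. Writing the next power as the
`m`-th power applied to the image of `Φ` prepends the new letter. -/
theorem transferOp_pow_apply [CompactSpace X] [PerfectSpace X] (hdist : S.DistortionHypothesis)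
    (r σ : ℝ) (m : ℕ) (Φ : C(X, ℂ)) (x : X) :
    (S.transferOp r σ ^ m) Φ x = ∑ v : Fin m → Fin N,
      (((S.wordProb (List.ofFn v) * infDeriv (S.wordMap (List.ofFn v)) x ^ r) ^ (σ / (r + σ)) : ℝ)
        : ℂ) * Φ (S.wordMap (List.ofFn v) x) := by
  induction m generalizing Φ with
  | zero =>
    have h1 : infDeriv (id : X → X) x = 1 := (hasInfDerivAt_id x).infDeriv_eq
    simp [wordProb, wordMap, h1]
  | succ m ih =>
    rw [pow_succ, mul_apply_eq_comp, ih, sum_words_succ m fun w =>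
      (((S.wordProb w * infDeriv (S.wordMap w) x ^ r) ^ (σ / (r + σ)) : ℝ) : ℂ)
        * Φ (S.wordMap w x), Finset.sum_comm]
    refine Finset.sum_congr rfl fun v _ => ?_
    rw [transferOp_apply, Finset.mul_sum]
    refine Finset.sum_congr rfl fun i _ => ?_
    rw [← mul_assoc, ← Complex.ofReal_mul, S.wordProb_cons, S.infDeriv_wordMap_cons hdist]
    have hD := S.infDeriv_wordMap_pos hdist (List.ofFn v) x
    have hDi := S.infDeriv_pos i (S.wordMap (List.ofFn v) x)
    have hp := S.wordProb_pos (List.ofFn v)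
    have hpi := S.p_pos i
    rw [← Real.mul_rpow (by positivity) (by positivity), Real.mul_rpow hDi.le hD.le]
    congr 3
    ring_nf

/-- A common contraction constant. -/
theorem exists_lipschitzWith : ∃ c : ℝ≥0, c < 1 ∧ ∀ w : List (Fin N),
    LipschitzWith (c ^ w.length) (S.wordMap w) := by
  choose c hc using S.contracting
  refine ⟨Finset.univ.sup c, (Finset.sup_lt_iff one_pos).2 fun i _ => (hc i).1, fun w => ?_⟩
  induction w with
  | nil =>
    rw [List.length_nil, pow_zero]
    exact LipschitzWith.id
  | cons i w ih =>
    rw [List.length_cons, pow_succ']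
    exact ((hc i).2.weaken (Finset.le_sup (Finset.mem_univ i))).comp ih

/-- Lower Lipschitz constants of the word maps, comparable to the infinitesimal derivatives. -/
theorem exists_lower_lipschitz [PerfectSpace X] [Nonempty X] (hdist : S.DistortionHypothesis) :
    ∃ (K : ℝ) (s : List (Fin N) → ℝ), 0 < K ∧ (∀ w, 0 < s w) ∧
      (∀ w x y, s w * dist x y ≤ dist (S.wordMap w x) (S.wordMap w y)) ∧
      ∀ w x, infDeriv (S.wordMap w) x ≤ K * s w := by
  have hd := hdist
  obtain ⟨C, hC, h⟩ := hd
  obtain ⟨o⟩ := ‹Nonempty X›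
  have hC0 : 0 < C := by linarith
  -- The same quotient is bounded below through the derivative at `x` and above through that at `y`.
  -- The empty word, outside the distortion hypothesis, has derivative 1.
  have hcmp : ∀ w x y, infDeriv (S.wordMap w) x ≤ C ^ 2 * infDeriv (S.wordMap w) y := by
    intro w x y
    have hpos := S.infDeriv_wordMap_pos hdist w
    by_cases hxy : x = y
    · subst hxy
      exact le_mul_of_one_le_left (hpos x).le (one_le_pow₀ hC)
    by_cases hw : w = []
    · subst hw
      rw [infDeriv_wordMap_nil, infDeriv_wordMap_nil, mul_one]
      exact one_le_pow₀ hC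
    have h1 := (h w hw x y hxy).1
    have h2 := (h w hw y x (Ne.symm hxy)).2
    rw [dist_comm, dist_comm y x] at h2
    have := h1.trans h2
    rw [div_le_iff₀ hC0] at this
    linarith
  -- One factor `C` comes from the lower distortion bound and two from moving the base point to `o`;
  -- moving back costs two more, whence `C ^ 5`.
  refine ⟨C ^ 5, fun w => infDeriv (S.wordMap w) o / C ^ 3, by positivity,
    fun w => div_pos (S.infDeriv_wordMap_pos hdist w o) (by positivity), fun w x y => ?_,
    fun w x => ?_⟩
  · by_cases hxy : x = y
    · simp [hxy]
    have hxy0 := dist_pos.2 hxy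
    by_cases hw : w = []
    · subst hw
      simp only [infDeriv_wordMap_nil]
      exact mul_le_of_le_one_left hxy0.le (div_le_one_of_le₀ (one_le_pow₀ hC) (by positivity))
    rw [← le_div_iff₀ hxy0]
    refine le_trans ?_ (h w hw x y hxy).1
    rw [div_le_div_iff₀ (by positivity) hC0]
    nlinarith [hcmp w o x]
  · have := hcmp w x o
    have e : C ^ 5 * (infDeriv (S.wordMap w) o / C ^ 3) = C ^ 2 * infDeriv (S.wordMap w) o := by
      field_simp
    linarith

/-! ### Invariance and the open set condition along words -/

theorem lintegral_eq_sum_words [MeasurableSpace X] [BorelSpace X] {μ : Measure X}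
    (hμ : S.IsInvariantMeasure μ) (m : ℕ) {F : X → ℝ≥0∞} (hF : Measurable F) :
    ∫⁻ x, F x ∂μ = ∑ v : Fin m → Fin N, ENNReal.ofReal (S.wordProb (List.ofFn v))
      * ∫⁻ x, F (S.wordMap (List.ofFn v) x) ∂μ := by
  induction m generalizing F with
  | zero => simp [wordProb, wordMap]
  | succ m ih =>
    rw [sum_words_succ m fun w => ENNReal.ofReal (S.wordProb w) * ∫⁻ x, F (S.wordMap w x) ∂μ]
    have h1 : ∫⁻ x, F x ∂μ = ∑ i, ENNReal.ofReal (S.p i) * ∫⁻ x, F (S.f i x) ∂μ := by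
      conv_lhs => rw [hμ]
      rw [lintegral_finsetSum_measure]
      refine Finset.sum_congr rfl fun i _ => ?_
      rw [lintegral_smul_measure, lintegral_map hF (S.continuous_f i).measurable, smul_eq_mul]
    rw [h1]
    refine Finset.sum_congr rfl fun i _ => ?_
    have h2 := ih (F := fun x => F (S.f i x)) (hF.comp (S.continuous_f i).measurable)
    rw [h2, Finset.mul_sum]
    refine Finset.sum_congr rfl fun v _ => ?_
    rw [wordProb_cons, ENNReal.ofReal_mul (S.p_pos i).le, mul_assoc]
    rfl

/-- Only one term of the iterated invariance is kept; this is how a fixed suffix is appended at the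
cost of its probability. -/
theorem wordProb_mul_lintegral_le [MeasurableSpace X] [BorelSpace X] {μ : Measure X}
    (hμ : S.IsInvariantMeasure μ) (w : List (Fin N)) {F : X → ℝ≥0∞} (hF : Measurable F) :
    ENNReal.ofReal (S.wordProb w) * ∫⁻ x, F (S.wordMap w x) ∂μ ≤ ∫⁻ x, F x ∂μ := by
  rw [S.lintegral_eq_sum_words hμ w.length hF]
  have := Finset.single_le_sum (s := Finset.univ)
    (f := fun v : Fin w.length → Fin N => ENNReal.ofReal (S.wordProb (List.ofFn v))
      * ∫⁻ x, F (S.wordMap (List.ofFn v) x) ∂μ) (fun _ _ => zero_le) (Finset.mem_univ w.get)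
  simpa only [List.ofFn_get] using this

theorem image_wordMap_subset {G : Set X} (hG : ∀ i, S.f i '' G ⊆ G) (w : List (Fin N)) :
    S.wordMap w '' G ⊆ G := by
  induction w with
  | nil => simp [wordMap]
  | cons i w ih =>
    rw [wordMap, Set.image_comp]
    exact (Set.image_mono ih).trans (hG i)

/-- Disjointness arises at the first differing letter and is carried through the common prefix by
injectivity. -/
theorem disjoint_image_wordMap (hdist : S.DistortionHypothesis) {G : Set X}
    (hG : ∀ i, S.f i '' G ⊆ G) (hdisj : ∀ i j, i ≠ j → Disjoint (S.f i '' G) (S.f j '' G))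
    (v w : List (Fin N)) (hlen : v.length = w.length) (hne : v ≠ w) :
    Disjoint (S.wordMap v '' G) (S.wordMap w '' G) := by
  induction v generalizing w with
  | nil => exact absurd (List.length_eq_zero_iff.1 hlen.symm).symm hne
  | cons i v ih =>
    cases w with
    | nil => simp at hlen
    | cons j w =>
      simp only [wordMap, Set.image_comp]
      by_cases hij : i = j
      · subst hij
        rw [Set.disjoint_image_iff (S.injective_f hdist i)]
        exact ih w (by simpa using hlen) fun h => hne (by rw [h])
      · exact (hdisj i j hij).mono (Set.image_mono (S.image_wordMap_subset hG v))
          (Set.image_mono (S.image_wordMap_subset hG w))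

/-- Under the strong open set condition some word map sends the whole space into the open set. -/
theorem exists_wordMap_mem [CompactSpace X] {G E : Set X} (hG : IsOpen G)
    (hE : S.IsAttractor E) (hEG : (E ∩ G).Nonempty) :
    ∃ u : List (Fin N), ∀ x, S.wordMap u x ∈ G := by
  obtain ⟨x, hxE, hxG⟩ := hEG
  have hword : ∀ (k : ℕ) (x : X), x ∈ E → ∃ (u : List (Fin N)) (y : X),
      u.length = k ∧ S.wordMap u y = x := by
    intro k
    induction k with
    | zero => exact fun x _ => ⟨[], x, rfl, rfl⟩
    | succ k ih =>
      intro x hx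
      rw [hE.2.2] at hx
      obtain ⟨i, y, hy, rfl⟩ := Set.mem_iUnion.1 hx
      obtain ⟨u, z, hu, rfl⟩ := ih y hy
      exact ⟨i :: u, z, by simp [hu], rfl⟩
  obtain ⟨c, hc, hlip⟩ := S.exists_lipschitzWith
  obtain ⟨ε, hε, hball⟩ := Metric.isOpen_iff.1 hG x hxG
  have hlim : Tendsto (fun k : ℕ => (c : ℝ) ^ k * Metric.diam (Set.univ : Set X)) atTop (𝓝 0) := by
    simpa using (tendsto_pow_atTop_nhds_zero_of_lt_one c.2 hc).mul_const
      (Metric.diam (Set.univ : Set X))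
  -- A cylinder of this level containing `x` has diameter below `ε`, so the image of all of `X`
  -- stays in the ball inside `G`.
  obtain ⟨k, hk⟩ := (hlim.eventually (gt_mem_nhds hε)).exists
  obtain ⟨u, y, hu, hux⟩ := hword k x hxE
  refine ⟨u, fun z => hball ?_⟩
  rw [Metric.mem_ball, ← hux]
  refine ((hlip u).dist_le_mul z y).trans_lt (lt_of_le_of_lt ?_ hk)
  rw [hu]
  push_cast
  gcongr
  exact Metric.dist_le_diam_of_mem isCompact_univ.isBounded trivial trivial

/-- The sum bounds the norm of the `m`-th power of the operator. Were it below 1, the spectral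
radius, being at most the `m`-th root of that norm, would be below 1 too. -/
theorem one_le_sum_words_of_spectralRadius [CompactSpace X] [PerfectSpace X]
    (hdist : S.DistortionHypothesis) {r σ : ℝ} (hr : 0 < r) (hσ : 0 ≤ σ)
    (hspr : spectralRadius ℂ (S.transferOp r σ) = 1) {B : List (Fin N) → ℝ}
    (hB : ∀ w x, infDeriv (S.wordMap w) x ≤ B w) (hB0 : ∀ w, 0 ≤ B w) {m : ℕ} (hm : 0 < m) :
    1 ≤ ∑ v : Fin m → Fin N,
      (S.wordProb (List.ofFn v) * B (List.ofFn v) ^ r) ^ (σ / (r + σ)) := by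
  have ht : 0 ≤ σ / (r + σ) := by positivity
  set Z := ∑ v : Fin m → Fin N,
      (S.wordProb (List.ofFn v) * B (List.ofFn v) ^ r) ^ (σ / (r + σ)) with hZ
  have hterm : ∀ w, 0 ≤ (S.wordProb w * B w ^ r) ^ (σ / (r + σ)) := fun w =>
    Real.rpow_nonneg (mul_nonneg (S.wordProb_pos w).le (Real.rpow_nonneg (hB0 w) _)) _
  have hZ0 : 0 ≤ Z := Finset.sum_nonneg fun v _ => hterm _
  have hnorm : ‖S.transferOp r σ ^ m‖ ≤ Z := by
    refine ContinuousLinearMap.opNorm_le_bound _ hZ0 fun Φ => ?_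
    rw [ContinuousMap.norm_le _ (by positivity)]
    intro x
    rw [S.transferOp_pow_apply hdist, hZ, Finset.sum_mul]
    refine (norm_sum_le _ _).trans (Finset.sum_le_sum fun v _ => ?_)
    have hD := S.infDeriv_wordMap_pos hdist (List.ofFn v) x
    have hp := S.wordProb_pos (List.ofFn v)
    rw [norm_mul, Complex.norm_real, Real.norm_of_nonneg (by positivity)]
    have := Φ.norm_coe_le_norm (S.wordMap (List.ofFn v) x)
    have := hB (List.ofFn v) x
    have := hterm (List.ofFn v)
    gcongr
  obtain ⟨n, rfl⟩ : ∃ n, m = n + 1 := ⟨m - 1, by omega⟩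
  have h1 := spectrum.spectralRadius_le_pow_nnnorm_pow_one_div ℂ (S.transferOp r σ) n
  rw [hspr] at h1
  have hn : (0 : ℝ) ≤ 1 / ((n : ℝ) + 1) := by positivity
  have hid : ‖(1 : C(X, ℂ) →L[ℂ] C(X, ℂ))‖₊ ≤ 1 := ContinuousLinearMap.norm_id_le
  have h2 : (‖(1 : C(X, ℂ) →L[ℂ] C(X, ℂ))‖₊ : ℝ≥0∞) ^ (1 / ((n : ℝ) + 1)) ≤ 1 :=
    ENNReal.rpow_le_one (by exact_mod_cast hid) hn
  by_contra hlt
  rw [not_le] at hlt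
  have h3 : (‖S.transferOp r σ ^ (n + 1)‖₊ : ℝ≥0∞) < 1 := by
    have : ‖S.transferOp r σ ^ (n + 1)‖₊ < 1 := hnorm.trans_lt hlt
    exact_mod_cast this
  have h4 := ENNReal.rpow_lt_one h3 (z := 1 / ((n : ℝ) + 1)) (by positivity)
  exact absurd h1 (not_le.2 (lt_of_le_of_lt (mul_le_of_le_one_right zero_le h2) h4))

end InfSimilitudeIFS

/-! ### Truncated integrals and separation of compact images -/

theorem quantErrorV_ge_of_lintegral_min {X : Type*} [MetricSpace X] [MeasurableSpace X]
    [BorelSpace X] {μ : Measure X} {r : ℝ} (hr : 0 < r) {n : ℕ} {b δ : ℝ≥0∞}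
    (h : ∀ A : Finset X, A.card ≤ n → ∀ h : X → X → ℝ≥0∞, (∀ j, Measurable (h j)) →
      (∀ j x y, edist x y ≤ h j x + h j y) → b ≤ ∫⁻ x, (min δ (⨅ j ∈ A, h j x)) ^ r ∂μ) :
    b ≤ quantErrorV μ r n := by
  refine le_iInf₂ fun A hA => ?_
  refine (h A hA (fun j x => edist x j) (fun j => (continuous_id.edist continuous_const).measurable)
    fun j x y => edist_triangle_right x y j).trans (lintegral_mono fun x => ?_)
  exact ENNReal.rpow_le_rpow (min_le_right _ _) hr.le

/-- Disjoint compact sets lie at positive distance, and there are finitely many pairs. -/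
theorem exists_pos_le_edist_of_disjoint_range {X ι : Type*} [MetricSpace X] [CompactSpace X]
    [Finite ι] {g : ι → X → X} (hg : ∀ i, Continuous (g i))
    (h : ∀ i j, i ≠ j → Disjoint (Set.range (g i)) (Set.range (g j))) :
    ∃ δ : ℝ≥0, 0 < δ ∧ ∀ i j, i ≠ j → ∀ x y, 2 * (δ : ℝ≥0∞) ≤ edist (g i x) (g j y) := by
  have hR : ∀ i j, ∃ R : ℝ≥0, 0 < R ∧ (i ≠ j → ∀ x y, (R : ℝ≥0∞) ≤ edist (g i x) (g j y)) := by
    intro i j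
    by_cases hij : i = j
    · exact ⟨1, one_pos, fun h => absurd hij h⟩
    obtain ⟨R, hR0, hR⟩ := Metric.exists_pos_forall_lt_edist (isCompact_range (hg i))
      (isCompact_range (hg j)).isClosed (h i j hij)
    exact ⟨R, hR0, fun _ x y => (hR _ ⟨x, rfl⟩ _ ⟨y, rfl⟩).le⟩
  choose R hR0 hR using hR
  have hev : ∀ᶠ δ in 𝓝[>] (0 : ℝ≥0), ∀ i j, 2 * δ ≤ R i j := by
    refine eventually_all.2 fun i => eventually_all.2 fun j => ?_
    have h0 : Tendsto (fun δ : ℝ≥0 => 2 * δ) (𝓝[>] 0) (𝓝 0) := by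
      have : Continuous fun δ : ℝ≥0 => 2 * δ := by fun_prop
      simpa using (this.tendsto 0).mono_left nhdsWithin_le_nhds
    exact (h0.eventually (gt_mem_nhds (hR0 i j))).mono fun _ h => h.le
  obtain ⟨δ, hδ, hδ0⟩ := (hev.and self_mem_nhdsWithin).exists
  exact ⟨δ, hδ0, fun i j hij x y => le_trans (by exact_mod_cast hδ i j) (hR i j hij x y)⟩

/-! ### Construction of the separated family below the critical exponent -/

namespace InfSimilitudeIFS

variable {X : Type*} [MetricSpace X] {N : ℕ} (S : InfSimilitudeIFS X N)

/-- Below the critical exponent the sums over words of length `m` can be made large. -/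
theorem exists_large_sum_words [CompactSpace X] [PerfectSpace X]
    (hdist : S.DistortionHypothesis) {r σ l : ℝ} (hr : 0 < r) (hl : 0 < l) (hlσ : l < σ)
    (hspr : spectralRadius ℂ (S.transferOp r σ) = 1) {K : ℝ} (hK : 0 < K)
    {s : List (Fin N) → ℝ} (hs : ∀ w, 0 < s w)
    (hsK : ∀ w x, infDeriv (S.wordMap w) x ≤ K * s w) {c : ℝ≥0} (hc : c < 1)
    (hsc : ∀ w, s w ≤ (c : ℝ) ^ w.length) {κ : ℝ} (hκ : 0 < κ) :
    ∃ m : ℕ, 0 < m ∧ 1 ≤ κ * ∑ v : Fin m → Fin N,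
      (S.wordProb (List.ofFn v) * s (List.ofFn v) ^ r) ^ (l / (r + l)) := by
  have hσ : 0 < σ := hl.trans hlσ
  set t := σ / (r + σ) with ht
  set t' := l / (r + l) with ht'
  have htt : 0 < t - t' := by
    rw [sub_pos, div_lt_div_iff₀ (by positivity) (by positivity)]
    nlinarith
  -- This factor bounds the ratio of a summand with exponent `t` (including the distortion constant
  -- `K`) to its counterpart with exponent `t'`, since `p_w * s w ^ r ≤ (c ^ m) ^ r` and `t > t'`.
  -- Large `m` pushes it below `κ`.
  have hlim : Tendsto (fun m : ℕ => (K ^ r) ^ t * (((c : ℝ) ^ m) ^ r) ^ (t - t')) atTop (𝓝 0) := by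
    have h0 := tendsto_pow_atTop_nhds_zero_of_lt_one c.2 (show (c : ℝ) < 1 from hc)
    have h1 := h0.rpow_const (p := r) (Or.inr hr.le)
    rw [Real.zero_rpow hr.ne'] at h1
    have h2 := h1.rpow_const (p := t - t') (Or.inr htt.le)
    rw [Real.zero_rpow htt.ne'] at h2
    simpa using h2.const_mul ((K ^ r) ^ t)
  obtain ⟨m, hm, hm0⟩ := ((hlim.eventually (gt_mem_nhds hκ)).and (eventually_gt_atTop 0)).exists
  refine ⟨m, hm0, (S.one_le_sum_words_of_spectralRadius hdist hr hσ.le hspr hsK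
    (fun w => (mul_pos hK (hs w)).le) hm0).trans ?_⟩
  rw [Finset.mul_sum]
  refine Finset.sum_le_sum fun v _ => ?_
  set w := List.ofFn v with hw
  have hp := S.wordProb_pos w
  have hsw := hs w
  set y := S.wordProb w * s w ^ r with hy
  have hy0 : 0 < y := by positivity
  have hyc : y ≤ ((c : ℝ) ^ m) ^ r := by
    have h1 := hsc w
    rw [hw, List.length_ofFn, ← hw] at h1
    calc y ≤ s w ^ r := mul_le_of_le_one_left (by positivity) (S.wordProb_le_one w)
      _ ≤ _ := Real.rpow_le_rpow hsw.le h1 hr.le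
  calc (S.wordProb w * (K * s w) ^ r) ^ t = (K ^ r) ^ t * y ^ (t - t') * y ^ t' := by
        rw [mul_assoc, ← Real.rpow_add hy0, sub_add_cancel,
          ← Real.mul_rpow (by positivity) hy0.le, Real.mul_rpow hK.le hsw.le, hy]
        ring_nf
    _ ≤ (K ^ r) ^ t * (((c : ℝ) ^ m) ^ r) ^ (t - t') * y ^ t' := by gcongr
    _ ≤ κ * y ^ t' := by gcongr

/-- The separated bound is applied to the maps of the words `v ++ u` with `v` of length `m`, with
weights `S.wordProb (v ++ u)` and Lipschitz constants `s v * s u`. -/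
theorem exists_const_le_quantErrorV [CompactSpace X] [PerfectSpace X] [MeasurableSpace X]
    [BorelSpace X] (hdist : S.DistortionHypothesis) (hSOSC : S.SOSC) (μ : Measure X)
    [IsProbabilityMeasure μ] (hμ : S.IsInvariantMeasure μ) {r σ l : ℝ} (hr : 0 < r) (hl : 0 < l)
    (hlσ : l < σ) (hspr : spectralRadius ℂ (S.transferOp r σ) = 1) :
    ∃ c : ℝ, 0 < c ∧ ∀ n : ℕ, 1 ≤ n →
      ENNReal.ofReal (c * (n : ℝ) ^ (-(r / l))) ≤ quantErrorV μ r n := by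
  obtain ⟨G, hGo, -, -, hG, hdisj, E, hE, hEG⟩ := hSOSC
  have hX : Nonempty X := ⟨hE.1.some⟩
  obtain ⟨o⟩ := id hX
  -- Two distinct points allow the lower Lipschitz constants to be compared with the upper ones.
  obtain ⟨o', ho'⟩ : ∃ y, y ≠ o := by
    have := perfectSpace_iff_forall_not_isolated.1 (inferInstanceAs (PerfectSpace X)) o
    exact this.nonempty_of_mem self_mem_nhdsWithin
  obtain ⟨K, s, hK, hs, hlow, hsK⟩ := S.exists_lower_lipschitz hdist
  obtain ⟨c, hc, hlip⟩ := S.exists_lipschitzWith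
  obtain ⟨u, hu⟩ := S.exists_wordMap_mem hGo hE hEG
  have hsc : ∀ w, s w ≤ (c : ℝ) ^ w.length := by
    intro w
    have h1 := (hlow w o' o).trans ((hlip w).dist_le_mul o' o)
    push_cast at h1
    exact le_of_mul_le_mul_right h1 (dist_pos.2 ho')
  have hpu := S.wordProb_pos u
  have hsu := hs u
  -- Here `κ` is the factor that the suffix `u` contributes to every summand.
  obtain ⟨m, hm0, hm⟩ := S.exists_large_sum_words hdist hr hl hlσ hspr hK hs hsK hc hsc
    (κ := (S.wordProb u * s u ^ r) ^ (l / (r + l))) (by positivity)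
  have hq0 : ∀ w, 0 < S.wordProb (w ++ u) := fun w => S.wordProb_pos _
  have ha0 : ∀ w, 0 < s w * s u := fun w => mul_pos (hs w) hsu
  have ha1 : ∀ v : Fin m → Fin N, s (List.ofFn v) * s u < 1 := by
    intro v
    have h1 := hsc (List.ofFn v)
    rw [List.length_ofFn] at h1
    have h2 : s u ≤ 1 := (hsc u).trans (pow_le_one₀ c.2 hc.le)
    exact (mul_le_of_le_one_right (hs _).le h2).trans_lt
      (h1.trans_lt (pow_lt_one₀ c.2 hc hm0.ne'))
  have hβ : (1 + r / l)⁻¹ = l / (r + l) := by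
    field_simp
    ring
  obtain ⟨δ, hδ, hsep⟩ := exists_pos_le_edist_of_disjoint_range
    (g := fun v : Fin m → Fin N => S.wordMap (List.ofFn v ++ u))
    (fun v => S.continuous_wordMap _) (fun v v' hv => by
      have := S.disjoint_image_wordMap hdist hG hdisj (List.ofFn v) (List.ofFn v') (by simp)
        fun h => hv (List.ofFn_injective h)
      refine this.mono ?_ ?_
      all_goals
        rintro _ ⟨x, rfl⟩
        simp only [wordMap_append]
        exact ⟨_, hu x, rfl⟩)
  obtain ⟨C, hC0, hC⟩ := exists_const_le_lintegral_min_of_separated μ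
    (fun v : Fin m → Fin N => S.wordMap (List.ofFn v ++ u))
    (fun v => (S.continuous_wordMap _).measurable)
    (fun v => (S.wordProb (List.ofFn v ++ u)).toNNReal)
    (fun v => (s (List.ofFn v) * s u).toNNReal)
    (fun v => Real.toNNReal_pos.2 (hq0 _)) (fun v => Real.toNNReal_pos.2 (ha0 _))
    (fun v => Real.toNNReal_le_one.2 (ha1 v).le)
    (fun v x y => by
      rw [edist_dist, edist_dist]
      change ENNReal.ofReal _ * _ ≤ _
      rw [← ENNReal.ofReal_mul (ha0 _).le, wordMap_append]
      refine ENNReal.ofReal_le_ofReal (le_trans ?_ (hlow _ _ _))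
      rw [mul_assoc]
      exact mul_le_mul_of_nonneg_left (hlow u x y) (hs _).le)
    hδ hsep
    (fun F hF => by
      rw [S.lintegral_eq_sum_words hμ m hF]
      refine Finset.sum_le_sum fun v _ => ?_
      change ENNReal.ofReal _ * _ ≤ _
      rw [wordProb_append, wordMap_append, ENNReal.ofReal_mul (S.wordProb_pos _).le, mul_assoc]
      gcongr
      exact S.wordProb_mul_lintegral_le hμ u
        (F := fun x => F (S.wordMap (List.ofFn v) x))
        (hF.comp (S.continuous_wordMap _).measurable))
    hr (div_pos hr hl)
    (fun v => by
      rw [Real.coe_toNNReal _ (hq0 _).le, Real.coe_toNNReal _ (ha0 _).le]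
      exact (mul_le_of_le_one_left (Real.rpow_nonneg (ha0 _).le _)
        (S.wordProb_le_one _)).trans_lt (Real.rpow_lt_one (ha0 _).le (ha1 v) hr))
    (by
      refine hm.trans_eq ?_
      rw [Finset.mul_sum, hβ]
      refine Finset.sum_congr rfl fun v _ => ?_
      have h1 := S.wordProb_pos (List.ofFn v)
      have h2 := hs (List.ofFn v)
      rw [Real.coe_toNNReal _ (hq0 _).le, Real.coe_toNNReal _ (ha0 _).le, wordProb_append,
        ← Real.mul_rpow (by positivity) (by positivity), Real.mul_rpow h2.le hsu.le]
      ring_nf)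
  exact ⟨C, hC0, fun n hn => quantErrorV_ge_of_lintegral_min hr (hC X n hn)⟩

end InfSimilitudeIFS

/-! ### From error bounds to the lower quantization dimension -/

/-- This makes `-log V` positive, so that dividing by it preserves inequalities. The centres of a
finite cover by balls of radius 1/2 suffice. -/
theorem eventually_quantErrorV_lt_one {X : Type*} [MetricSpace X] [CompactSpace X]
    [MeasurableSpace X] (μ : Measure X) [IsProbabilityMeasure μ] {r : ℝ} (hr : 0 < r) :
    ∀ᶠ n in atTop, quantErrorV μ r n < 1 := by
  obtain ⟨T, -, hT, hcov⟩ := (isCompact_univ (X := X)).finite_cover_balls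
    (show (0 : ℝ) < 1 / 2 by norm_num)
  filter_upwards [eventually_ge_atTop hT.toFinset.card] with n hn
  have hhalf : ENNReal.ofReal (1 / 2) < 1 := by
    rw [← ENNReal.ofReal_one, ENNReal.ofReal_lt_ofReal_iff one_pos]
    norm_num
  refine lt_of_le_of_lt ((iInf₂_le hT.toFinset hn).trans (?_ : _ ≤ ENNReal.ofReal (1 / 2) ^ r))
    (ENNReal.rpow_lt_one hhalf hr)
  calc _ ≤ ∫⁻ _, ENNReal.ofReal (1 / 2) ^ r ∂μ := by
        refine lintegral_mono fun x => ENNReal.rpow_le_rpow ?_ hr.le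
        obtain ⟨y, hy, hxy⟩ := Set.mem_iUnion₂.1 (hcov (Set.mem_univ x))
        refine (Metric.infEDist_le_edist_of_mem (y := y) (by simpa using hy)).trans ?_
        rw [edist_dist]
        exact ENNReal.ofReal_le_ofReal (Metric.mem_ball.1 hxy).le
    _ = _ := by simp

/-- The gap between `z` and `l` leaves a positive multiple of `log n`, which eventually absorbs the
constant `log c`. -/
theorem eventually_le_div_neg_log {V : ℕ → ℝ≥0∞} {r l z c : ℝ} (hr : 0 < r) (hz : 0 < z)
    (hzl : z < l) (hc : 0 < c) (hV : ∀ᶠ n in atTop, V n < 1)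
    (hVc : ∀ n : ℕ, 1 ≤ n → ENNReal.ofReal (c * (n : ℝ) ^ (-(r / l))) ≤ V n) :
    ∀ᶠ n : ℕ in atTop, (z : EReal) ≤ ((r * Real.log n : ℝ) : EReal) / (-ENNReal.log (V n)) := by
  have hl : 0 < l := hz.trans hzl
  have hlog : Tendsto (fun n : ℕ => (r - z * (r / l)) * Real.log n) atTop atTop := by
    refine (Real.tendsto_log_atTop.comp tendsto_natCast_atTop_atTop).const_mul_atTop ?_
    have : r - z * (r / l) = r * (l - z) / l := by field_simp
    rw [this]
    exact div_pos (mul_pos hr (sub_pos.2 hzl)) hl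
  filter_upwards [hV, eventually_ge_atTop 1, hlog.eventually_ge_atTop (-(z * Real.log c))]
    with n hn1 hn hnlog
  have hn0 : (0 : ℝ) < n := by exact_mod_cast hn
  have hb0 : 0 < c * (n : ℝ) ^ (-(r / l)) := mul_pos hc (Real.rpow_pos_of_pos hn0 _)
  have h1 := ENNReal.log_monotone (hVc n hn)
  rw [ENNReal.log_ofReal, if_neg (not_le.2 hb0), Real.log_mul hc.ne'
    (Real.rpow_pos_of_pos hn0 _).ne', Real.log_rpow hn0] at h1
  have h2 : -ENNReal.log (V n) ≤ ((-(Real.log c + -(r / l) * Real.log n) : ℝ) : EReal) := by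
    rw [EReal.coe_neg]
    exact EReal.neg_le_neg_iff.2 h1
  have h3 : 0 < -ENNReal.log (V n) := by
    have : ENNReal.log (V n) < 0 := by
      rw [← ENNReal.log_one]
      exact ENNReal.log_strictMono hn1
    simpa using EReal.neg_lt_neg_iff.2 this
  rw [EReal.le_div_iff_mul_le h3 (h2.trans_lt (EReal.coe_lt_top _)).ne]
  refine (mul_le_mul_of_nonneg_left h2 (by exact_mod_cast hz.le)).trans ?_
  rw [← EReal.coe_mul, EReal.coe_le_coe_iff]
  linarith

theorem mainTheorem4 {X : Type*} [MetricSpace X] [CompactSpace X] [PerfectSpace X]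
    [MeasurableSpace X] [BorelSpace X] {N : ℕ} (S : InfSimilitudeIFS X N)
    (hdist : S.DistortionHypothesis) (hSOSC : S.SOSC)
    (μ : Measure X) [IsProbabilityMeasure μ] (hμ : S.IsInvariantMeasure μ)
    (r : ℝ) (hr : 0 < r)
    (σ : ℝ) (hσ : 0 ≤ σ) (hspr : spectralRadius ℂ (S.transferOp r σ) = 1) :
    (∀ l : ℝ, 0 < l → l < σ →
      0 < liminf (fun n : ℕ => (n : ℝ≥0∞) * quantError μ r n ^ l) atTop) ∧
    (σ : EReal) ≤ lowerQuantDim μ r := by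
  constructor
  · intro l hl hlσ
    obtain ⟨c, hc, h⟩ := S.exists_const_le_quantErrorV hdist hSOSC μ hμ hr hl hlσ hspr
    refine lt_of_lt_of_le (ENNReal.ofReal_pos.2 (Real.rpow_pos_of_pos hc (l / r)))
      (le_liminf_of_le (by isBoundedDefault) ?_)
    filter_upwards [eventually_ge_atTop 1] with n hn
    have hn0 : (0 : ℝ) < n := by exact_mod_cast hn
    have hb0 : 0 < c * (n : ℝ) ^ (-(r / l)) := mul_pos hc (Real.rpow_pos_of_pos hn0 _)
    have hlr : 0 < l / r := div_pos hl hr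
    -- Raising the bound on `V` to the power `l / r` turns `n ^ (-(r / l))` into `n⁻¹`, so the
    -- prefactor `n` cancels.
    have e : c ^ (l / r) = n * (c * (n : ℝ) ^ (-(r / l))) ^ (l / r) := by
      have : -(r / l) * (l / r) = -1 := by field_simp
      rw [Real.mul_rpow hc.le (by positivity), ← Real.rpow_mul hn0.le, this, Real.rpow_neg_one]
      field_simp
    rw [quantError, ← ENNReal.rpow_mul, one_div_mul_eq_div, e, ENNReal.ofReal_mul hn0.le,
      ENNReal.ofReal_natCast, ← ENNReal.ofReal_rpow_of_pos hb0]
    gcongr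
    exact h n hn
  · have hV := eventually_quantErrorV_lt_one μ hr
    refine EReal.ge_of_forall_gt_iff_ge.1 fun z hz => ?_
    refine le_liminf_of_le (by isBoundedDefault) ?_
    -- For `z ≤ 0` nonnegativity of the quotient suffices, which also settles `σ = 0`. For `z > 0`
    -- an intermediate `l` with `z < l < σ` is used.
    rcases le_or_gt z 0 with hz0 | hz0
    · filter_upwards [hV, eventually_ge_atTop 1] with n hn1 hn
      refine le_trans (by exact_mod_cast hz0) (EReal.div_nonneg ?_ ?_)
      · exact_mod_cast mul_nonneg hr.le (Real.log_nonneg (by exact_mod_cast hn))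
      · have := ENNReal.log_monotone hn1.le
        rw [ENNReal.log_one] at this
        simpa using EReal.neg_le_neg_iff.2 this
    · obtain ⟨l, hzl, hlσ⟩ := exists_between (EReal.coe_lt_coe_iff.1 hz)
      obtain ⟨c, hc, h⟩ := S.exists_const_le_quantErrorV hdist hSOSC μ hμ hr (hz0.trans hzl) hlσ
        hspr
      exact eventually_le_div_neg_log hr hz0 hzl hc hV h
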